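/- Let $\Omega\subset\mathbb{R}^2$ be a convex polygon (the convex hull of finitely many points, with nonempty interior). For distinct $p,q\in\operatorname{int}(\Omega)$ let $p',q'$ be the endpoints of the chord of $\Omega$ through $p$ and $q$, in the order $p',p,q,q'$, and let $$d_\Omega(p,q)=\frac12\ln\left(\frac{\|q-p'\|}{\|p-p'\|}\cdot\frac{\|p-q'\|}{\|q-q'\|}\right),\qquad d_\Omega(p,p)=0,$$ be the Hilbert distance. For $c,p\in\operatorname{int}(\Omega)$ let $B(c,p)=\{q\in\operatorname{int}(\Omega): d_\Omega(c,q)\le d_\Omega(c,p)\}$ be the Hilbert ball centered at $c$ of radius $d_\Omega(c,p)$. Let $x\in\partial\Omega$, let $p\in\operatorname{int}(\Omega)$, let $u$ be a unit vector directed from $x$ into the interior of $\Omega$ (that is, $x+tu\in\operatorname{int}(\Omega)$ for some $t>0$), and put $x_\delta=x+\delta u$ for $\delta>0$. Then, as $\delta\to0^+$, the balls $B(x_\delta,p)$ converge in the Hausdorff distance to a nonempty compact set, necessarily unique, called the Hilbert ball at infinity $B_u(x,p)$. Moreover, $B_u(x,p)$ is a convex polygon (with nonempty interior), it is contained in $\Omega$,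 and both $x$ and $p$ lie on its boundary. -/

import Mathlib

/-- The Euclidean plane. -/
abbrev Plane : Type := EuclideanSpace ℝ (Fin 2)

/-- A convex polygon: the convex hull of finitely many points of the plane, with nonempty interior
(hence a closed, bounded, full-dimensional convex set). -/
def IsConvexPolygon (Ω : Set Plane) : Prop :=
  (∃ V : Finset Plane, Ω = convexHull ℝ (V : Set Plane)) ∧ (interior Ω).Nonempty

/-- For distinct `p`, `q` in `Ω`, the endpoint beyond `q` of the chord of `Ω` through `p` and `q`:
the last point of `Ω` on the ray from `p` through `q`. -/
noncomputable def chordEnd (Ω : Set Plane) (p q : Plane) : Plane :=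
  AffineMap.lineMap p q (sSup {t : ℝ | AffineMap.lineMap p q t ∈ Ω})

open Classical in
/-- The Hilbert distance: with `p' = chordEnd Ω q p` and `q' = chordEnd Ω p q` the endpoints of the
chord through `p ≠ q`, in the order `p', p, q, q'`, it is half the logarithm of the cross ratio
`(‖q - p'‖ / ‖p - p'‖) * (‖p - q'‖ / ‖q - q'‖)`; and it is `0` if `p = q`. -/
noncomputable def hilbertDist (Ω : Set Plane) (p q : Plane) : ℝ :=
  if p = q then 0
  else 1 / 2 * Real.log
    ((‖q - chordEnd Ω q p‖ / ‖p - chordEnd Ω q p‖) *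
      (‖p - chordEnd Ω p q‖ / ‖q - chordEnd Ω p q‖))

/-- The (closed) Hilbert ball of radius `ρ` centered at `c`. -/
def hilbertBall (Ω : Set Plane) (c : Plane) (ρ : ℝ) : Set Plane :=
  {q | q ∈ interior Ω ∧ hilbertDist Ω c q ≤ ρ}

/-- The Hilbert ball centered at `c` whose boundary passes through `p`. -/
def hilbertBallThrough (Ω : Set Plane) (c p : Plane) : Set Plane :=
  hilbertBall Ω c (hilbertDist Ω c p)

/-- `u` is a unit vector directed from `x` into the interior of `Ω`. -/
def IsInwardDirection (Ω : Set Plane) (x u : Plane) : Prop :=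
  ‖u‖ = 1 ∧ ∃ t : ℝ, 0 < t ∧ x + t • u ∈ interior Ω

open Filter Topology in
/-- `K` is the Hilbert ball at infinity determined by `x` and `u` and passing through `p`: the
nonempty compact set to which the balls centered at `x + δ • u` through `p` converge in the
Hausdorff distance as `δ` decreases to `0`. -/
def IsHilbertBallAtInfinity (Ω : Set Plane) (x u p : Plane) (K : Set Plane) : Prop :=
  K.Nonempty ∧ IsCompact K ∧
    Tendsto (fun δ : ℝ => Metric.hausdorffEDist (hilbertBallThrough Ω (x + δ • u) p) K)
      (𝓝[>] 0) (𝓝 0)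

/-! Write Ω as `{q | ∀ i, 0 ≤ f i q}` with finitely many affine `f i`. A chord leaves Ω where some
`f i` first vanishes, so exp(2 d(c,q)) is the maximum over pairs (i,j) of f_i(c) f_j(q) / (f_i(q)
f_j(c)) (`exists_isGreatest_hilbertDist`). With R = exp(2 d(c,p)), the ball through p is therefore
cut out of the interior by the inequalities f_i(c) f_j(q) ≤ R f_j(c) f_i(q), which are affine in q.

At c = x + δu, R grows like 1/δ, while f_j(c) decays like δ when f_j(x) = 0. Passing to S = δR, and
multiplying by δ the inequalities with f_j(x) ≠ 0, makes all coefficients continuous at δ = 0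
(`ballFunction`, `hilbertBallThrough_eq`). The limiting system has a strict solution on the ray from
x (`exists_ballFunction_zero_pos`); this yields both Hausdorff convergence
(`tendsto_hausdorffEDist_of_affineMap`) and nonempty interior.

The limit K is compact and given by finitely many affine inequalities, hence a polygon. It contains
x and lies in Ω, so x stays on the frontier; an inequality attaining the maximum that defines S is
an equality at p. -/

/-! ### Polytopes as solution sets of affine inequalities -/

section Polytope

variable {E : Type*} [NormedAddCommGroup E] [NormedSpace ℝ E]

theorem AffineMap.real_apply_lineMap (f : E →ᵃ[ℝ] ℝ) (a b : E) (t : ℝ) :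
    f (AffineMap.lineMap a b t) = (1 - t) * f a + t * f b := by
  rw [AffineMap.apply_lineMap, AffineMap.lineMap_apply_ring']
  ring

theorem AffineMap.real_apply_add_smul (f : E →ᵃ[ℝ] ℝ) (x u : E) (t : ℝ) :
    f (x + t • u) = f x + t * f.linear u := by
  have h := f.map_vadd x (t • u)
  rw [vadd_eq_add, vadd_eq_add, map_smul, smul_eq_mul, add_comm] at h
  rw [h, add_comm]

/-- An affine function that is nonnegative on `s` and positive somewhere is positive on the
interior of `s`. -/
theorem AffineMap.pos_of_mem_interior (f : E →ᵃ[ℝ] ℝ) {s : Set E} (hs : ∀ y ∈ s, 0 ≤ f y)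
    {z : E} (hz : 0 < f z) {q : E} (hq : q ∈ interior s) : 0 < f q := by
  have hc : Continuous fun t : ℝ => AffineMap.lineMap q z t := AffineMap.lineMap_continuous
  have h0 : (fun t : ℝ => AffineMap.lineMap q z t) ⁻¹' interior s ∈ nhds (0 : ℝ) :=
    hc.continuousAt.preimage_mem_nhds (by simpa using isOpen_interior.mem_nhds hq)
  obtain ⟨ε, hε, hb⟩ := Metric.mem_nhds_iff.1 h0
  -- Step past `q`, away from `z`: if `f q ≤ 0`, then `f` would be negative there.
  have hm : (AffineMap.lineMap q z (-(ε / 2)) : E) ∈ interior s :=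
    hb (by rw [Metric.mem_ball, Real.dist_eq, sub_zero, abs_neg, abs_of_pos] <;> linarith)
  have h1 := hs _ (interior_subset hm)
  rw [AffineMap.real_apply_lineMap] at h1
  by_contra hn
  nlinarith

variable {ι : Type*}

theorem convex_setOf_forall_affineMap_nonneg (f : ι → E →ᵃ[ℝ] ℝ) :
    Convex ℝ {q | ∀ i, 0 ≤ f i q} := by
  have : {q | ∀ i, 0 ≤ f i q} = ⋂ i, (f i) ⁻¹' Set.Ici 0 := by ext; simp
  rw [this]
  exact convex_iInter fun i => (convex_Ici 0).affine_preimage (f i)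

/-- An extreme point of the solution set of finitely many affine inequalities is determined by the
set of inequalities that are tight at it. -/
theorem finite_extremePoints_setOf_forall_affineMap_nonneg [Finite ι] (f : ι → E →ᵃ[ℝ] ℝ) :
    (Set.extremePoints ℝ {q | ∀ i, 0 ≤ f i q}).Finite := by
  classical
  cases nonempty_fintype ι
  refine Set.Finite.of_injOn (f := fun q => {i | f i q = 0}) (t := Set.univ)
    (fun _ _ => Set.mem_univ _) ?_ Set.finite_univ
  intro q hq r hr hqr
  obtain ⟨hqK, hqe⟩ := hq
  -- Moving from `q` along the line to `r`, both ways, preserves every inequality: those tight at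
  -- `q` are tight at `r`, hence on the whole line, and the strict ones survive by continuity.
  -- Extremality then forces `r = q`.
  have hev : ∀ i, ∀ᶠ t : ℝ in nhds 0,
      0 ≤ f i (AffineMap.lineMap q r t) ∧ 0 ≤ f i (AffineMap.lineMap q r (-t)) := by
    intro i
    simp only [AffineMap.real_apply_lineMap]
    by_cases hi : f i q = 0
    · have hi' : f i r = 0 := by
        have : i ∈ {i | f i q = 0} := hi
        rw [show {i | f i q = 0} = {i | f i r = 0} from hqr] at this
        exact this
      simp [hi, hi']
    · have hpos : 0 < f i q := lt_of_le_of_ne (hqK i) (Ne.symm hi)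
      have c1 : Continuous fun t : ℝ => (1 - t) * f i q + t * f i r := by fun_prop
      have c2 : Continuous fun t : ℝ => (1 - -t) * f i q + -t * f i r := by fun_prop
      have e1 := (c1.tendsto 0).eventually_const_lt (u := 0) (by simpa using hpos)
      have e2 := (c2.tendsto 0).eventually_const_lt (u := 0) (by simpa using hpos)
      filter_upwards [e1, e2] with t h1 h2 using ⟨h1.le, h2.le⟩
  obtain ⟨ε, hε, hb⟩ := Metric.eventually_nhds_iff.1 (Filter.eventually_all.2 hev)
  have hh := hb (y := ε / 2) (by rw [Real.dist_eq, sub_zero, abs_of_pos] <;> linarith)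
  have hs : q ∈ openSegment ℝ (AffineMap.lineMap q r (ε / 2) : E)
      (AffineMap.lineMap q r (-(ε / 2))) := by
    refine ⟨1 / 2, 1 / 2, by norm_num, by norm_num, by norm_num, ?_⟩
    simp only [AffineMap.lineMap_apply_module]
    module
  have he := hqe (fun i => (hh i).1) (fun i => (hh i).2) hs
  have he' : (ε / 2) • (r - q) = 0 := by
    rw [AffineMap.lineMap_apply_module', add_eq_right] at he
    exact he
  rcases smul_eq_zero.1 he' with h | h
  · linarith
  · exact (sub_eq_zero.1 h).symm

/-- A compact solution set of finitely many affine inequalities is the convex hull of a finite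
set. -/
theorem exists_finset_convexHull_eq_of_isCompact [Finite ι] (f : ι → E →ᵃ[ℝ] ℝ)
    (hK : IsCompact {q | ∀ i, 0 ≤ f i q}) :
    ∃ V : Finset E, {q | ∀ i, 0 ≤ f i q} = convexHull ℝ (V : Set E) := by
  have hfin := finite_extremePoints_setOf_forall_affineMap_nonneg f
  refine ⟨hfin.toFinset, ?_⟩
  rw [hfin.coe_toFinset]
  conv_lhs => rw [← closure_convexHull_extremePoints hK (convex_setOf_forall_affineMap_nonneg f)]
  exact (hfin.isClosed_convexHull ℝ).closure_eq

variable [FiniteDimensional ℝ E]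

theorem AffineMap.continuous_real (f : E →ᵃ[ℝ] ℝ) : Continuous f :=
  f.continuous_of_finiteDimensional

/-- The polar body, with respect to an interior point, of the convex hull of a finite set is the
convex hull of a finite set. -/
theorem exists_finset_polar_eq_convexHull (V : Finset E) {z : E}
    (hz : z ∈ interior (convexHull ℝ (V : Set E))) :
    ∃ W : Finset (StrongDual ℝ E),
      {l : StrongDual ℝ E | ∀ v : V, l (v - z) ≤ 1} = convexHull ℝ (W : Set (StrongDual ℝ E)) := by
  let g : V → StrongDual ℝ E →ᵃ[ℝ] ℝ := fun v =>
    AffineMap.const ℝ (StrongDual ℝ E) (1 : ℝ) -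
      ((ContinuousLinearMap.apply ℝ ℝ ((v : E) - z)).toLinearMap.toAffineMap)
  have hg : ∀ v l, g v l = 1 - l (v - z) := fun v l => rfl
  have hset : {l : StrongDual ℝ E | ∀ v : V, l (v - z) ≤ 1} = {l | ∀ v, 0 ≤ g v l} := by
    ext l
    simp only [Set.mem_ofPred_eq, hg, sub_nonneg]
  rw [hset]
  refine exists_finset_convexHull_eq_of_isCompact g ?_
  refine Metric.isCompact_of_isClosed_isBounded ?_ ?_
  · simp only [Set.ofPred_forall]
    exact isClosed_iInter fun v => isClosed_le continuous_const (g v).continuous_real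
  · obtain ⟨r, hr, hb⟩ := Metric.isOpen_iff.1 isOpen_interior z hz
    refine (isBounded_iff_forall_norm_le).2 ⟨2 / r, fun l hl => ?_⟩
    have hle : ∀ y ∈ convexHull ℝ (V : Set E), l (y - z) ≤ 1 := by
      intro y hy
      have hsub : (V : Set E) ⊆ {y | l y ≤ 1 + l z} := fun v hv => by
        have := hl ⟨v, hv⟩
        rw [hg, map_sub] at this
        simp only [Set.mem_ofPred_eq]
        linarith
      have := convexHull_min hsub (convex_halfSpace_le l.isLinear _) hy
      simp only [Set.mem_ofPred_eq] at this
      rw [map_sub]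
      linarith
    have hball : ∀ y : E, ‖y‖ < r → l y ≤ 1 := fun y hy => by
      have := hle (z + y) (interior_subset (hb (by simpa using hy)))
      simpa using this
    refine ContinuousLinearMap.opNorm_le_bound l (by positivity) fun y => ?_
    rcases eq_or_ne y 0 with rfl | hy
    · simp
    have hy' : 0 < ‖y‖ := norm_pos_iff.2 hy
    -- `y` is rescaled to norm `r / 2`, where both `l` and `-l` are at most 1.
    have hn : ‖(r / (2 * ‖y‖)) • y‖ < r := by
      rw [norm_smul, Real.norm_of_nonneg (by positivity)]
      field_simp
      linarith
    have h1 := hball _ hn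
    have h2 := hball (-((r / (2 * ‖y‖)) • y)) (by rwa [norm_neg])
    rw [map_neg] at h2
    rw [map_smul, smul_eq_mul] at h1 h2
    have h3 : r / (2 * ‖y‖) * |l y| ≤ 1 := by
      rcases abs_cases (l y) with ⟨h, _⟩ | ⟨h, _⟩ <;> rw [h] <;> linarith
    rw [Real.norm_eq_abs]
    calc |l y| = (2 * ‖y‖ / r) * (r / (2 * ‖y‖) * |l y|) := by field_simp
      _ ≤ (2 * ‖y‖ / r) * 1 := by gcongr
      _ = 2 / r * ‖y‖ := by ring

/-- The convex hull of a finite set, if it has an interior point, is the solution set of finitely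
many affine inequalities that are strict at that point. -/
theorem exists_affineMap_convexHull_eq (V : Finset E) {z : E}
    (hz : z ∈ interior (convexHull ℝ (V : Set E))) :
    ∃ W : Finset (StrongDual ℝ E), ∃ f : W → E →ᵃ[ℝ] ℝ, (∀ i, 0 < f i z) ∧
      convexHull ℝ (V : Set E) = {q | ∀ i, 0 ≤ f i q} := by
  obtain ⟨W, hW⟩ := exists_finset_polar_eq_convexHull V hz
  let f : W → E →ᵃ[ℝ] ℝ := fun w => AffineMap.const ℝ E (1 + (w : StrongDual ℝ E) z) -
    (w : StrongDual ℝ E).toLinearMap.toAffineMap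
  have hf : ∀ w q, f w q = 1 + (w : StrongDual ℝ E) z - (w : StrongDual ℝ E) q := fun w q => rfl
  refine ⟨W, f, fun i => by rw [hf]; linarith, Set.Subset.antisymm ?_ ?_⟩
  · refine convexHull_min (fun v hv w => ?_) (convex_setOf_forall_affineMap_nonneg f)
    have hw : (w : StrongDual ℝ E) ∈ {l : StrongDual ℝ E | ∀ v : V, l (v - z) ≤ 1} := by
      rw [hW]
      exact subset_convexHull ℝ _ w.2
    have := hw ⟨v, hv⟩
    rw [map_sub] at this
    rw [hf]
    linarith
  · intro q hq
    by_contra hn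
    obtain ⟨l, s, hl, hs⟩ := geometric_hahn_banach_closed_point (convex_convexHull ℝ (V : Set E))
      (V.finite_toSet.isClosed_convexHull ℝ) hn
    have hzs : 0 < s - l z := by linarith [hl z (interior_subset hz)]
    -- The separating functional, normalized, lies in the polar body, hence in the hull of `W`; so
    -- the inequalities from `W` already bound it at `q`.
    have hmem : (s - l z)⁻¹ • l ∈ {l : StrongDual ℝ E | ∀ v : V, l (v - z) ≤ 1} := by
      intro v
      have := hl v (subset_convexHull ℝ _ v.2)
      rw [smul_apply, smul_eq_mul, map_sub, inv_mul_le_iff₀ hzs]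
      linarith
    rw [hW] at hmem
    have hsub : (W : Set (StrongDual ℝ E)) ⊆ {l | l (q - z) ≤ 1} := fun w hw => by
      have := hq ⟨w, hw⟩
      rw [hf] at this
      simp only [Set.mem_ofPred_eq, map_sub]
      linarith
    have hc : Convex ℝ {l : StrongDual ℝ E | l (q - z) ≤ 1} :=
      convex_halfSpace_le (ContinuousLinearMap.apply ℝ ℝ (q - z)).isLinear 1
    have := convexHull_min hsub hc hmem
    rw [Set.mem_ofPred_eq, smul_apply, smul_eq_mul, map_sub, inv_mul_le_iff₀ hzs] at this
    linarith

theorem interior_setOf_forall_affineMap_nonneg [Finite ι] {f : ι → E →ᵃ[ℝ] ℝ} {z : E}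
    (hz : ∀ i, 0 < f i z) : interior {q | ∀ i, 0 ≤ f i q} = {q | ∀ i, 0 < f i q} := by
  refine Set.Subset.antisymm
    (fun q hq i => (f i).pos_of_mem_interior
      (s := {q | ∀ i, 0 ≤ f i q}) (fun y hy => hy i) (hz i) hq) ?_
  refine interior_maximal (fun q hq i => (hq i).le) ?_
  simp only [Set.ofPred_forall]
  exact isOpen_iInter_of_finite fun i => isOpen_lt continuous_const (f i).continuous_real

end Polytope

/-! ### Hausdorff stability of affine systems -/

open Filter Topology in
/-- Sets cut out of a bounded convex set by affine inequalities depend continuously on the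
inequalities, in the Hausdorff distance, near a system that is strictly solvable. -/
theorem tendsto_hausdorffEDist_of_affineMap {E ι α : Type*} [NormedAddCommGroup E]
    [NormedSpace ℝ E] [Finite ι] {l : Filter α} {Ω : Set E} (hΩ : Convex ℝ Ω)
    (hb : Bornology.IsBounded Ω) {h₀ : ι → E →ᵃ[ℝ] ℝ} {h : α → ι → E →ᵃ[ℝ] ℝ}
    (hlim : ∀ i, ∀ ε > 0, ∀ᶠ a in l, ∀ q ∈ Ω, |h a i q - h₀ i q| ≤ ε)
    {z : E} (hz : z ∈ interior Ω) (hpos : ∀ i, 0 < h₀ i z) :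
    Tendsto (fun a => Metric.hausdorffEDist {q | q ∈ interior Ω ∧ ∀ i, 0 ≤ h a i q}
      {q | q ∈ Ω ∧ ∀ i, 0 ≤ h₀ i q}) l (𝓝 0) := by
  obtain ⟨D, hD⟩ := Metric.isBounded_iff.1 hb
  have hD0 : 0 ≤ D := dist_nonneg.trans (hD (interior_subset hz) (interior_subset hz))
  have key : ∀ s : ℝ, 0 < s → s < 1 → ∀ᶠ a in l,
      Metric.hausdorffEDist {q | q ∈ interior Ω ∧ ∀ i, 0 ≤ h a i q}
        {q | q ∈ Ω ∧ ∀ i, 0 ≤ h₀ i q} ≤ ENNReal.ofReal (s * D) := by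
    intro s hs hs1
    -- Moving a point the fraction `s` of the way to `z` gains `s * h₀ i z`, enough to absorb an
    -- error of that size in either direction.
    have hev := eventually_all.2 fun i => hlim i (s * h₀ i z) (mul_pos hs (hpos i))
    filter_upwards [hev] with a ha
    have hzΩ := interior_subset hz
    have hint : ∀ q ∈ Ω, (AffineMap.lineMap q z s : E) ∈ interior Ω := fun q hq => by
      rw [AffineMap.lineMap_apply_module]
      exact hΩ.combo_self_interior_mem_interior hq hz (by linarith) hs (by ring)
    have hdist : ∀ q ∈ Ω, edist q (AffineMap.lineMap q z s : E) ≤ ENNReal.ofReal (s * D) := by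
      intro q hq
      rw [edist_dist, dist_left_lineMap, Real.norm_of_nonneg hs.le]
      exact ENNReal.ofReal_le_ofReal (mul_le_mul_of_nonneg_left (hD hq hzΩ) hs.le)
    refine Metric.hausdorffEDist_le_of_mem_edist ?_ ?_
    · rintro q ⟨hq, hqi⟩
      have hqΩ := interior_subset hq
      refine ⟨_, ⟨interior_subset (hint q hqΩ), fun i => ?_⟩, hdist q hqΩ⟩
      have h1 := (abs_le.1 (ha i q hqΩ)).2
      rw [AffineMap.real_apply_lineMap]
      have h2 := hqi i
      have h3 := mul_pos hs (hpos i)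
      nlinarith
    · rintro q ⟨hqΩ, hqi⟩
      refine ⟨_, ⟨hint q hqΩ, fun i => ?_⟩, hdist q hqΩ⟩
      have h1 := (abs_le.1 (ha i _ (interior_subset (hint q hqΩ)))).1
      rw [AffineMap.real_apply_lineMap (h₀ i)] at h1
      have h2 := mul_nonneg (sub_nonneg.2 hs1.le) (hqi i)
      linarith
  refine ENNReal.tendsto_nhds_zero.2 fun ε hε => ?_
  obtain ⟨r, hr0, hr⟩ := ENNReal.lt_iff_exists_nnreal_btwn.1 hε
  have hr0' : 0 < (r : ℝ) := by exact_mod_cast hr0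
  have hs : 0 < (r : ℝ) / (r + D + 1) := by positivity
  have hs1 : (r : ℝ) / (r + D + 1) < 1 := by
    rw [div_lt_one (by positivity)]
    linarith
  filter_upwards [key _ hs hs1] with a ha
  refine ha.trans (le_trans ?_ hr.le)
  rw [← ENNReal.ofReal_coe_nnreal]
  refine ENNReal.ofReal_le_ofReal ?_
  rw [div_mul_eq_mul_div, div_le_iff₀ (by positivity)]
  nlinarith

/-! ### The Hilbert distance through the defining functions -/

section HilbertDist

variable {ι : Type*} {Ω : Set Plane} {f : ι → Plane →ᵃ[ℝ] ℝ}

/-- In a compact polygon given by affine inequalities, the ratio of the distances from `p` and `q`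
to the end of the chord beyond `q` is the greatest of the ratios of the defining functions. -/
theorem isGreatest_chordEnd_ratio [Finite ι] (hf : Ω = {q | ∀ i, 0 ≤ f i q})
    (hint : interior Ω = {q | ∀ i, 0 < f i q}) (hc : IsCompact Ω) {p q : Plane}
    (hp : p ∈ interior Ω) (hq : q ∈ interior Ω) (hpq : p ≠ q) :
    IsGreatest (Set.range fun i => f i p / f i q)
      (‖p - chordEnd Ω p q‖ / ‖q - chordEnd Ω p q‖) := by
  set T : Set ℝ := {t | AffineMap.lineMap p q t ∈ Ω} with hT
  have hcont : Continuous fun t : ℝ => (AffineMap.lineMap p q t : Plane) :=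
    AffineMap.lineMap_continuous
  have hpq0 : 0 < dist p q := dist_pos.2 hpq
  have h1T : (1 : ℝ) ∈ T := by simpa [hT] using interior_subset hq
  have hTb : BddAbove T := by
    obtain ⟨D, hD⟩ := Metric.isBounded_iff.1 hc.isBounded
    refine ⟨D / dist p q, fun t ht => ?_⟩
    have h := hD (interior_subset hp) ht
    rw [dist_left_lineMap, Real.norm_eq_abs] at h
    rw [le_div_iff₀ hpq0]
    exact (mul_le_mul_of_nonneg_right (le_abs_self t) hpq0.le).trans h
  have hTc : IsClosed T := hc.isClosed.preimage hcont
  set t := sSup T with ht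
  have htT : t ∈ T := hTc.csSup_mem ⟨1, h1T⟩ hTb
  have ht1 : 1 ≤ t := le_csSup hTb h1T
  have hpi : ∀ i, 0 < f i p := by rw [hint] at hp; exact hp
  have hqi : ∀ i, 0 < f i q := by rw [hint] at hq; exact hq
  have htf : ∀ i, 0 ≤ (1 - t) * f i p + t * f i q := fun i => by
    rw [← AffineMap.real_apply_lineMap]
    have h : (AffineMap.lineMap p q t : Plane) ∈ Ω := htT
    rw [hf] at h
    exact h i
  -- If no constraint were tight at the chord end, the chord could be prolonged. A tight constraint
  -- has ratio exactly `t / (t - 1)`; nonnegativity of the others bounds theirs by it.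
  obtain ⟨i, hi⟩ : ∃ i, (1 - t) * f i p + t * f i q = 0 := by
    by_contra! hne
    have hmem : (AffineMap.lineMap p q t : Plane) ∈ interior Ω := by
      rw [hint]
      intro i
      rw [AffineMap.real_apply_lineMap]
      exact lt_of_le_of_ne (htf i) (hne i).symm
    have hnb : (fun t : ℝ => (AffineMap.lineMap p q t : Plane)) ⁻¹' interior Ω ∈ nhds t :=
      hcont.continuousAt.preimage_mem_nhds (isOpen_interior.mem_nhds hmem)
    obtain ⟨ε, hε, hb⟩ := Metric.mem_nhds_iff.1 hnb
    have hm : t + ε / 2 ∈ T := interior_subset (s := Ω) <| hb (by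
      rw [Metric.mem_ball, Real.dist_eq, add_sub_cancel_left, abs_of_pos] <;> linarith)
    linarith [le_csSup hTb hm]
  have ht1' : 1 < t := by
    refine lt_of_le_of_ne ht1 fun h => ?_
    rw [← h] at hi
    linarith [hqi i]
  have hr : ‖p - chordEnd Ω p q‖ / ‖q - chordEnd Ω p q‖ = t / (t - 1) := by
    rw [chordEnd, ← hT, ← ht, ← dist_eq_norm, ← dist_eq_norm, dist_left_lineMap,
      dist_right_lineMap, Real.norm_of_nonneg (by linarith), Real.norm_of_nonpos (by linarith),
      mul_div_mul_right _ _ hpq0.ne', neg_sub]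
  rw [hr]
  refine ⟨⟨i, ?_⟩, ?_⟩
  · change f i p / f i q = _
    rw [div_eq_div_iff (hqi i).ne' (by linarith)]
    linarith
  · rintro _ ⟨j, rfl⟩
    change f j p / f j q ≤ _
    rw [div_le_div_iff₀ (hqi j) (by linarith)]
    linarith [htf j]

/-- The two chord ends give two independent maxima of positive ratios, whose product is the maximum
over pairs of indices. -/
theorem exists_isGreatest_hilbertDist [Finite ι] [Nonempty ι] (hf : Ω = {q | ∀ i, 0 ≤ f i q})
    (hint : interior Ω = {q | ∀ i, 0 < f i q}) (hc : IsCompact Ω) {c q : Plane}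
    (hcΩ : c ∈ interior Ω) (hq : q ∈ interior Ω) :
    ∃ G, IsGreatest (Set.range fun k : ι × ι => f k.1 c / f k.1 q * (f k.2 q / f k.2 c)) G ∧
      0 < G ∧ hilbertDist Ω c q = 1 / 2 * Real.log G := by
  have hci : ∀ i, 0 < f i c := by rw [hint] at hcΩ; exact hcΩ
  have hqi : ∀ i, 0 < f i q := by rw [hint] at hq; exact hq
  rcases eq_or_ne c q with rfl | hne
  · refine ⟨1, ⟨⟨Classical.arbitrary _, ?_⟩, ?_⟩, one_pos, by simp [hilbertDist]⟩
    · simp [div_self (hci _).ne']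
    · rintro _ ⟨k, rfl⟩
      simp [div_self (hci _).ne']
  · obtain ⟨⟨i, hi⟩, hi'⟩ := isGreatest_chordEnd_ratio hf hint hc hcΩ hq hne
    obtain ⟨⟨j, hj⟩, hj'⟩ := isGreatest_chordEnd_ratio hf hint hc hq hcΩ hne.symm
    simp only at hi hj
    refine ⟨f i c / f i q * (f j q / f j c), ⟨⟨(i, j), rfl⟩, ?_⟩, ?_, ?_⟩
    · rintro _ ⟨k, rfl⟩
      have h1 := hi' ⟨k.1, rfl⟩
      have h2 := hj' ⟨k.2, rfl⟩
      simp only [← hi, ← hj] at h1 h2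
      exact mul_le_mul h1 h2 (div_pos (hqi _) (hci _)).le (div_pos (hci _) (hqi _)).le
    · exact mul_pos (div_pos (hci _) (hqi _)) (div_pos (hqi _) (hci _))
    · rw [hilbertDist, if_neg hne, hi, hj, mul_comm (_ / _) (‖c - _‖ / _)]

/-- Comparison of Hilbert distances in terms of the defining functions of the polygon. -/
theorem hilbertDist_le_iff [Fintype ι] [Nonempty ι] (hf : Ω = {q | ∀ i, 0 ≤ f i q})
    (hint : interior Ω = {q | ∀ i, 0 < f i q}) (hc : IsCompact Ω) {c p q : Plane}
    (hcΩ : c ∈ interior Ω) (hp : p ∈ interior Ω) (hq : q ∈ interior Ω) :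
    hilbertDist Ω c q ≤ hilbertDist Ω c p ↔
      ∀ k : ι × ι, f k.1 c / f k.1 q * (f k.2 q / f k.2 c) ≤
        Finset.univ.sup' Finset.univ_nonempty
          fun k : ι × ι => f k.1 c / f k.1 p * (f k.2 p / f k.2 c) := by
  obtain ⟨G, hG, hG0, hGd⟩ := exists_isGreatest_hilbertDist hf hint hc hcΩ hq
  obtain ⟨R, hR, hR0, hRd⟩ := exists_isGreatest_hilbertDist hf hint hc hcΩ hp
  have hsup : (Finset.univ.sup' Finset.univ_nonempty
      fun k : ι × ι => f k.1 c / f k.1 p * (f k.2 p / f k.2 c)) = R := by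
    refine le_antisymm (Finset.sup'_le _ _ fun k _ => hR.2 ⟨k, rfl⟩) ?_
    obtain ⟨k, rfl⟩ := hR.1
    exact Finset.le_sup' (fun k : ι × ι => f k.1 c / f k.1 p * (f k.2 p / f k.2 c))
      (Finset.mem_univ k)
  rw [hsup, hGd, hRd, mul_le_mul_iff_right₀ (by norm_num), Real.log_le_log_iff hG0 hR0,
    isLUB_le_iff hG.isLUB]
  exact Set.forall_mem_range

end HilbertDist

/-! ### Rescaled inequalities and their limit at δ = 0 -/

section Limit

variable {E ι : Type*} [NormedAddCommGroup E] [NormedSpace ℝ E]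

/-- The factor by which the inequalities of index `j` are rescaled: `1` if the `j`-th constraint is
tight at `x`, and `δ` otherwise. -/
noncomputable def contactScale (f : ι → E →ᵃ[ℝ] ℝ) (x : E) (δ : ℝ) (j : ι) : ℝ :=
  if f j x = 0 then 1 else δ

/-- The value of the `j`-th defining function at `x + δ • u`, divided by `δ` if the constraint is
tight at `x`. -/
noncomputable def contactSlope (f : ι → E →ᵃ[ℝ] ℝ) (x u : E) (δ : ℝ) (j : ι) : ℝ :=
  if f j x = 0 then (f j).linear u else f j (x + δ • u)

/-- The exponential of twice the Hilbert distance from `x + δ • u` to `p`, multiplied by `δ`, in a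
form that makes sense at `δ = 0`. -/
noncomputable def scaledRadius [Fintype ι] [Nonempty ι] (f : ι → E →ᵃ[ℝ] ℝ) (x u p : E)
    (δ : ℝ) : ℝ :=
  Finset.univ.sup' Finset.univ_nonempty fun k : ι × ι =>
    f k.1 (x + δ • u) * contactScale f x δ k.2 * f k.2 p / (f k.1 p * contactSlope f x u δ k.2)

/-- The affine functions cutting out the ball centered at `x + δ • u` through `p`, for `δ > 0`, and
the ball at infinity, for `δ = 0`. -/
noncomputable def ballFunction [Fintype ι] [Nonempty ι] (f : ι → E →ᵃ[ℝ] ℝ) (x u p : E)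
    (δ : ℝ) (k : ι × ι) : E →ᵃ[ℝ] ℝ :=
  (scaledRadius f x u p δ * contactSlope f x u δ k.2) • f k.1 -
    (contactScale f x δ k.2 * f k.1 (x + δ • u)) • f k.2

variable {f : ι → E →ᵃ[ℝ] ℝ} {x u p : E}

theorem contactScale_mul_apply (f : ι → E →ᵃ[ℝ] ℝ) (x u : E) (δ : ℝ) (j : ι) :
    contactScale f x δ j * f j (x + δ • u) = δ * contactSlope f x u δ j := by
  unfold contactScale contactSlope
  split_ifs with h
  · rw [AffineMap.real_apply_add_smul, h]
    ring
  · rfl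

theorem contactScale_pos {δ : ℝ} (hδ : 0 < δ) (j : ι) : 0 < contactScale f x δ j := by
  unfold contactScale
  split_ifs
  · exact one_pos
  · exact hδ

/-- If the segment from `x` to `x + T • u` enters the open polyhedron at its end, then it lies in
the open polyhedron except for `x`. -/
theorem apply_add_smul_gt {T t : ℝ} (hT : ∀ i, 0 < f i (x + T • u)) (ht : 0 < t) (htT : t < T)
    (i : ι) : (1 - t / T) * f i x < f i (x + t • u) := by
  have hT0 : 0 < T := ht.trans htT
  have h := hT i
  rw [AffineMap.real_apply_add_smul] at h ⊢
  have h2 : 0 < t / T * (f i x + T * (f i).linear u) := by positivity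
  have h3 : t / T * (f i x + T * (f i).linear u) = t / T * f i x + t * (f i).linear u := by
    field_simp
  linarith

theorem apply_add_smul_pos (hx : ∀ i, 0 ≤ f i x) {T t : ℝ} (hT : ∀ i, 0 < f i (x + T • u))
    (ht : 0 < t) (htT : t < T) (i : ι) : 0 < f i (x + t • u) := by
  have h : 0 ≤ 1 - t / T := by
    rw [sub_nonneg, div_le_one (ht.trans htT)]
    exact htT.le
  exact (mul_nonneg h (hx i)).trans_lt (apply_add_smul_gt hT ht htT i)

theorem contactSlope_pos_of_pos {δ : ℝ} (hδ : 0 < δ) (hc : ∀ i, 0 < f i (x + δ • u)) (j : ι) :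
    0 < contactSlope f x u δ j := by
  have h := mul_pos (contactScale_pos (f := f) (x := x) hδ j) (hc j)
  rw [contactScale_mul_apply] at h
  exact pos_of_mul_pos_right h hδ.le

/-- An inward direction strictly increases every constraint tight at `x`; this keeps the
denominators in `scaledRadius` nonzero at δ = 0. -/
theorem contactSlope_zero_pos (hx : ∀ i, 0 ≤ f i x) {T : ℝ} (hT0 : 0 < T)
    (hT : ∀ i, 0 < f i (x + T • u)) (j : ι) : 0 < contactSlope f x u 0 j := by
  unfold contactSlope
  split_ifs with h
  · have h1 := hT j
    rw [AffineMap.real_apply_add_smul, h, zero_add] at h1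
    exact pos_of_mul_pos_right h1 hT0.le
  · rw [zero_smul, add_zero]
    exact lt_of_le_of_ne (hx j) (Ne.symm h)

variable [Fintype ι] [Nonempty ι]

theorem ballFunction_apply (δ : ℝ) (k : ι × ι) (q : E) :
    ballFunction f x u p δ k q = scaledRadius f x u p δ * contactSlope f x u δ k.2 * f k.1 q -
      contactScale f x δ k.2 * f k.1 (x + δ • u) * f k.2 q := rfl

theorem ballFunction_apply_self_nonneg (hp : ∀ i, 0 < f i p) {δ : ℝ}
    (hs : ∀ j, 0 < contactSlope f x u δ j) (k : ι × ι) : 0 ≤ ballFunction f x u p δ k p := by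
  have h := Finset.le_sup' (fun k : ι × ι =>
    f k.1 (x + δ • u) * contactScale f x δ k.2 * f k.2 p / (f k.1 p * contactSlope f x u δ k.2))
      (Finset.mem_univ k)
  change _ ≤ scaledRadius f x u p δ at h
  rw [div_le_iff₀ (mul_pos (hp _) (hs _))] at h
  rw [ballFunction_apply]
  linarith

/-- The pair attaining the maximum in `scaledRadius` works. At δ = 0 this puts `p` on the frontier
of the limit. -/
theorem exists_ballFunction_apply_self_eq_zero (hp : ∀ i, 0 < f i p) {δ : ℝ}
    (hs : ∀ j, 0 < contactSlope f x u δ j) : ∃ k : ι × ι, ballFunction f x u p δ k p = 0 := by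
  obtain ⟨k, -, hk⟩ := Finset.exists_mem_eq_sup' (Finset.univ_nonempty (α := ι × ι))
    (fun k : ι × ι =>
    f k.1 (x + δ • u) * contactScale f x δ k.2 * f k.2 p / (f k.1 p * contactSlope f x u δ k.2))
  refine ⟨k, ?_⟩
  change scaledRadius f x u p δ = _ at hk
  rw [eq_div_iff (mul_pos (hp _) (hs _)).ne'] at hk
  rw [ballFunction_apply]
  linarith

theorem scaledRadius_zero_pos (hp : ∀ i, 0 < f i p) (hx : ∀ i, 0 ≤ f i x)
    (hs : ∀ j, 0 < contactSlope f x u 0 j) (htight : ∃ j, f j x = 0) (hloose : ∃ i, f i x ≠ 0) :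
    0 < scaledRadius f x u p 0 := by
  obtain ⟨j, hj⟩ := htight
  obtain ⟨i, hi⟩ := hloose
  refine lt_of_lt_of_le ?_ (Finset.le_sup' (fun k : ι × ι =>
    f k.1 (x + (0 : ℝ) • u) * contactScale f x 0 k.2 * f k.2 p /
      (f k.1 p * contactSlope f x u 0 k.2)) (Finset.mem_univ (i, j)))
  have hi' : 0 < f i x := lt_of_le_of_ne (hx i) (Ne.symm hi)
  have h1 : contactScale f x 0 j = 1 := if_pos hj
  simp only [zero_smul, add_zero, h1, mul_one]
  exact div_pos (mul_pos hi' (hp j)) (mul_pos (hp i) (hs j))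

/-- The subtracted term vanishes at `x`: either constraint `k.2` is tight there, or its scale is
zero. -/
theorem ballFunction_zero_apply_center_nonneg (hx : ∀ i, 0 ≤ f i x)
    (hs : ∀ j, 0 < contactSlope f x u 0 j) (hS : 0 < scaledRadius f x u p 0) (k : ι × ι) :
    0 ≤ ballFunction f x u p 0 k x := by
  have h : contactScale f x 0 k.2 * f k.2 x = 0 := by
    unfold contactScale
    split_ifs with h
    · rw [h, mul_zero]
    · rw [zero_mul]
  rw [ballFunction_apply, mul_right_comm (contactScale _ _ _ _), h, zero_mul, sub_zero]
  exact mul_nonneg (mul_pos hS (hs _)).le (hx _)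

/-- The limiting system of inequalities is strictly solvable, by a point on the ray from `x` in
direction `u`. -/
theorem exists_ballFunction_zero_pos (hx : ∀ i, 0 ≤ f i x)
    {T : ℝ} (hT0 : 0 < T) (hT : ∀ i, 0 < f i (x + T • u)) (hS : 0 < scaledRadius f x u p 0) :
    ∃ z : E, (∀ i, 0 < f i z) ∧ ∀ k, 0 < ballFunction f x u p 0 k z := by
  set S := scaledRadius f x u p 0 with hSdef
  have hs := contactSlope_zero_pos hx hT0 hT
  -- This is the solution of `S * (1 - t / T) = t`, which balances the two terms for a tight
  -- constraint.
  set t := S * T / (T + S) with htdef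
  have ht0 : 0 < t := by positivity
  have htT : t < T := by
    rw [htdef, div_lt_iff₀ (by positivity)]
    nlinarith
  have hpos := apply_add_smul_pos hx hT ht0 htT
  refine ⟨x + t • u, hpos, fun k => ?_⟩
  rw [ballFunction_apply, ← hSdef, zero_smul, add_zero]
  by_cases h : f k.2 x = 0
  · have h1 : contactScale f x 0 k.2 = 1 := if_pos h
    have h2 : contactSlope f x u 0 k.2 = (f k.2).linear u := if_pos h
    have h3 := hs k.2
    rw [h2] at h3
    rw [h1, h2, AffineMap.real_apply_add_smul (f k.2), h]
    have h4 := mul_lt_mul_of_pos_left (apply_add_smul_gt hT ht0 htT k.1) hS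
    have h5 : S * ((1 - t / T) * f k.1 x) = t * f k.1 x := by
      rw [htdef]
      field_simp
      ring
    rw [h5] at h4
    have h6 := mul_lt_mul_of_pos_right h4 h3
    linarith
  · have h1 : contactScale f x 0 k.2 = 0 := if_neg h
    rw [h1, zero_mul, zero_mul, sub_zero]
    exact mul_pos (mul_pos hS (hs _)) (hpos _)

end Limit

/-! ### Continuity in δ -/

section Continuity

variable {E ι : Type*} [NormedAddCommGroup E] [NormedSpace ℝ E]
  {f : ι → E →ᵃ[ℝ] ℝ} {x u p : E}

theorem continuous_apply_add_smul (g : E →ᵃ[ℝ] ℝ) (x u : E) :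
    Continuous fun δ : ℝ => g (x + δ • u) := by
  simp only [AffineMap.real_apply_add_smul]
  fun_prop

theorem continuous_contactScale (f : ι → E →ᵃ[ℝ] ℝ) (x : E) (j : ι) :
    Continuous fun δ => contactScale f x δ j := by
  unfold contactScale
  split_ifs <;> fun_prop

theorem continuous_contactSlope (f : ι → E →ᵃ[ℝ] ℝ) (x u : E) (j : ι) :
    Continuous fun δ => contactSlope f x u δ j := by
  unfold contactSlope
  split_ifs
  · exact continuous_const
  · exact continuous_apply_add_smul _ _ _

variable [Fintype ι] [Nonempty ι]

theorem continuousAt_scaledRadius (hp : ∀ i, 0 < f i p)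
    (hs : ∀ j, 0 < contactSlope f x u 0 j) : ContinuousAt (scaledRadius f x u p) 0 := by
  refine ContinuousAt.finset_sup'_apply _ fun k _ => ContinuousAt.div ?_ ?_
    (mul_pos (hp _) (hs _)).ne'
  · exact (((continuous_apply_add_smul _ _ _).mul (continuous_contactScale f x k.2)).mul
      continuous_const).continuousAt
  · exact (continuous_const.mul (continuous_contactSlope f x u k.2)).continuousAt

open Filter Topology in
/-- The functions cutting out the balls converge uniformly on sets where the defining functions of
the polyhedron are bounded. -/
theorem eventually_abs_ballFunction_sub_le (hp : ∀ i, 0 < f i p)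
    (hs : ∀ j, 0 < contactSlope f x u 0 j) {Ω : Set E} {M : ℝ}
    (hM : ∀ i, ∀ q ∈ Ω, |f i q| ≤ M) (k : ι × ι) {ε : ℝ} (hε : 0 < ε) :
    ∀ᶠ δ in 𝓝 0, ∀ q ∈ Ω, |ballFunction f x u p δ k q - ballFunction f x u p 0 k q| ≤ ε := by
  have c1 : ContinuousAt (fun δ => scaledRadius f x u p δ * contactSlope f x u δ k.2) 0 :=
    (continuousAt_scaledRadius hp hs).mul (continuous_contactSlope f x u k.2).continuousAt
  have c2 : ContinuousAt (fun δ : ℝ => contactScale f x δ k.2 * f k.1 (x + δ • u)) 0 :=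
    ((continuous_contactScale f x k.2).mul (continuous_apply_add_smul _ _ _)).continuousAt
  have hη : 0 < ε / (2 * (|M| + 1)) := by positivity
  filter_upwards [Metric.continuousAt_iff'.1 c1 _ hη, Metric.continuousAt_iff'.1 c2 _ hη]
    with δ h1 h2 q hq
  rw [Real.dist_eq] at h1 h2
  have hb : ∀ i, |f i q| ≤ |M| + 1 := fun i =>
    (hM i q hq).trans ((le_abs_self M).trans (by linarith))
  simp only [ballFunction_apply]
  set a := scaledRadius f x u p δ * contactSlope f x u δ k.2
  set a₀ := scaledRadius f x u p 0 * contactSlope f x u 0 k.2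
  set b := contactScale f x δ k.2 * f k.1 (x + δ • u)
  set b₀ := contactScale f x 0 k.2 * f k.1 (x + (0 : ℝ) • u)
  calc |a * f k.1 q - b * f k.2 q - (a₀ * f k.1 q - b₀ * f k.2 q)|
      = |(a - a₀) * f k.1 q - (b - b₀) * f k.2 q| := by ring_nf
    _ ≤ |(a - a₀) * f k.1 q| + |(b - b₀) * f k.2 q| := abs_sub _ _
    _ = |a - a₀| * |f k.1 q| + |b - b₀| * |f k.2 q| := by rw [abs_mul, abs_mul]
    _ ≤ ε / (2 * (|M| + 1)) * (|M| + 1) + ε / (2 * (|M| + 1)) * (|M| + 1) := by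
        gcongr
        · exact hb _
        · exact hb _
    _ = ε := by field_simp; ring

end Continuity

/-! ### Balls as affine systems -/

section Ball

variable {ι : Type*} [Fintype ι] [Nonempty ι] {Ω : Set Plane} {f : ι → Plane →ᵃ[ℝ] ℝ}
  {x u p : Plane}

/-- For small `δ > 0`, the ball centered at `x + δ • u` through `p` is cut out of the interior of
the polygon by the affine functions `ballFunction`. -/
theorem hilbertBallThrough_eq (hf : Ω = {q | ∀ i, 0 ≤ f i q})
    (hint : interior Ω = {q | ∀ i, 0 < f i q}) (hc : IsCompact Ω) (hp : p ∈ interior Ω)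
    {δ : ℝ} (hδ : 0 < δ) (hcΩ : x + δ • u ∈ interior Ω) :
    hilbertBallThrough Ω (x + δ • u) p =
      {q | q ∈ interior Ω ∧ ∀ k, 0 ≤ ballFunction f x u p δ k q} := by
  ext q
  refine and_congr_right fun hq => ?_
  have hci : ∀ i, 0 < f i (x + δ • u) := by rw [hint] at hcΩ; exact hcΩ
  have hqi : ∀ i, 0 < f i q := by rw [hint] at hq; exact hq
  have hpi : ∀ i, 0 < f i p := by rw [hint] at hp; exact hp
  have hs := contactSlope_pos_of_pos hδ hci
  rw [hilbertDist_le_iff hf hint hc hcΩ hp hq]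
  set R := Finset.univ.sup' Finset.univ_nonempty
    fun k : ι × ι => f k.1 (x + δ • u) / f k.1 p * (f k.2 p / f k.2 (x + δ • u)) with hR
  have hS : scaledRadius f x u p δ = δ * R := by
    -- Termwise, `contactScale / contactSlope` equals `δ / f k.2 (x + δ • u)`.
    rw [hR, Finset.mul₀_sup' hδ.le]
    refine Finset.sup'_congr _ rfl fun k _ => ?_
    have h := contactScale_mul_apply f x u δ k.2
    have h1 := (hci k.2).ne'
    have h2 := (hpi k.1).ne'
    have h3 := (hs k.2).ne'
    field_simp
    linear_combination f k.1 (x + δ • u) * f k.2 p * h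
  refine forall_congr' fun k => ?_
  have h := contactScale_mul_apply f x u δ k.2
  have he : 0 < contactScale f x δ k.2 := contactScale_pos hδ k.2
  rw [ballFunction_apply, hS, sub_nonneg, div_mul_div_comm,
    div_le_iff₀ (mul_pos (hqi _) (hci _)), ← mul_le_mul_iff_right₀ he]
  have e1 : contactScale f x δ k.2 * (R * (f k.1 q * f k.2 (x + δ • u))) =
      δ * R * contactSlope f x u δ k.2 * f k.1 q := by
    linear_combination R * f k.1 q * h
  rw [e1, mul_assoc (contactScale f x δ k.2)]

end Ball

/-! ### Uniqueness and the main theorem -/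

theorem IsHilbertBallAtInfinity.unique {Ω : Set Plane} {x u p : Plane} {K K' : Set Plane}
    (h : IsHilbertBallAtInfinity Ω x u p K) (h' : IsHilbertBallAtInfinity Ω x u p K') :
    K' = K := by
  obtain ⟨-, hK, ht⟩ := h
  obtain ⟨-, hK', ht'⟩ := h'
  rw [← hK'.isClosed.hausdorffEDist_zero_iff hK.isClosed]
  have hsum := ht'.add ht
  rw [add_zero] at hsum
  refine le_antisymm (ge_of_tendsto' hsum fun δ => ?_) bot_le
  rw [Metric.hausdorffEDist_comm (s := hilbertBallThrough Ω (x + δ • u) p) (t := K')]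
  exact Metric.hausdorffEDist_triangle

theorem mainTheorem10 (Ω : Set Plane) (hΩ : IsConvexPolygon Ω)
    (x : Plane) (hx : x ∈ frontier Ω)
    (u : Plane) (hu : IsInwardDirection Ω x u)
    (p : Plane) (hp : p ∈ interior Ω) :
    ∃ K : Set Plane,
      IsHilbertBallAtInfinity Ω x u p K ∧
      (∀ K' : Set Plane, IsHilbertBallAtInfinity Ω x u p K' → K' = K) ∧
      IsConvexPolygon K ∧ K ⊆ Ω ∧ x ∈ frontier K ∧ p ∈ frontier K := by
  obtain ⟨⟨V, hV⟩, -⟩ := hΩ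
  obtain ⟨W, f, hfp, hf⟩ := exists_affineMap_convexHull_eq V (hV ▸ hp)
  have hc : IsCompact Ω := hV ▸ V.finite_toSet.isCompact_convexHull ℝ
  rw [← hV] at hf
  have hint : interior Ω = {q | ∀ i, 0 < f i q} :=
    hf ▸ interior_setOf_forall_affineMap_nonneg hfp
  have hcv : Convex ℝ Ω := hf ▸ convex_setOf_forall_affineMap_nonneg f
  have hxΩ : x ∈ Ω := hc.isClosed.frontier_subset hx
  have hxi : ∀ i, 0 ≤ f i x := by rw [hf] at hxΩ; exact hxΩ
  obtain ⟨hu1, T, hT0, hTΩ⟩ := hu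
  have hT : ∀ i, 0 < f i (x + T • u) := by rw [hint] at hTΩ; exact hTΩ
  have htight : ∃ j, f j x = 0 := by
    by_contra! hne
    exact hx.2 (hint ▸ fun i => lt_of_le_of_ne (hxi i) (hne i).symm)
  -- Were all constraints tight at `x`, Ω would contain the whole ray from `x` along `u`,
  -- contradicting boundedness.
  have hloose : ∃ i, f i x ≠ 0 := by
    by_contra! hall
    obtain ⟨D, hD⟩ := Metric.isBounded_iff.1 hc.isBounded
    have hmem : x + (|D| + 1) • u ∈ Ω := by
      rw [hf]
      intro i
      have h := hT i
      rw [AffineMap.real_apply_add_smul, hall i, zero_add] at h ⊢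
      exact mul_nonneg (by positivity) (pos_of_mul_pos_right h hT0.le).le
    have h := hD hmem hxΩ
    rw [dist_eq_norm, add_sub_cancel_left, norm_smul, hu1, mul_one,
      Real.norm_of_nonneg (by positivity)] at h
    linarith [le_abs_self D]
  have : Nonempty W := ⟨htight.choose⟩
  have hs := contactSlope_zero_pos hxi hT0 hT
  have hS := scaledRadius_zero_pos hfp hxi hs htight hloose
  obtain ⟨z, hzf, hz⟩ := exists_ballFunction_zero_pos hxi hT0 hT hS
  have hzΩ : z ∈ interior Ω := hint ▸ hzf
  set K : Set Plane := {q | q ∈ Ω ∧ ∀ k, 0 ≤ ballFunction f x u p 0 k q} with hK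
  let g : W ⊕ W × W → Plane →ᵃ[ℝ] ℝ := Sum.elim f (ballFunction f x u p 0)
  have hKg : K = {q | ∀ i, 0 ≤ g i q} := by
    ext q
    rw [hK, hf]
    exact (Sum.forall (p := fun i => 0 ≤ g i q)).symm
  have hgz : ∀ i, 0 < g i z := Sum.forall.2 ⟨hzf, hz⟩
  have hKint : interior K = {q | ∀ i, 0 < g i q} :=
    hKg ▸ interior_setOf_forall_affineMap_nonneg hgz
  have hKΩ : K ⊆ Ω := fun q hq => hq.1
  have hKcl : IsClosed K := by
    rw [hKg]
    simp only [Set.ofPred_forall]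
    exact isClosed_iInter fun i => isClosed_le continuous_const (g i).continuous_real
  have hKc : IsCompact K := hc.of_isClosed_subset hKcl hKΩ
  have hxK : x ∈ K := ⟨hxΩ, ballFunction_zero_apply_center_nonneg hxi hs hS⟩
  have hpK : p ∈ K := ⟨interior_subset hp, ballFunction_apply_self_nonneg hfp hs⟩
  obtain ⟨M, hM⟩ : ∃ M, ∀ i, ∀ q ∈ Ω, |f i q| ≤ M := by
    choose C hC using fun i => hc.exists_bound_of_continuousOn (f i).continuous_real.continuousOn
    refine ⟨∑ i, |C i|, fun i q hq => (hC i q hq).trans ((le_abs_self _).trans ?_)⟩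
    exact Finset.single_le_sum (f := fun i => |C i|) (fun _ _ => abs_nonneg _) (Finset.mem_univ i)
  have hball : IsHilbertBallAtInfinity Ω x u p K := by
    refine ⟨⟨x, hxK⟩, hKc, ?_⟩
    refine (tendsto_hausdorffEDist_of_affineMap hcv hc.isBounded (h := ballFunction f x u p)
      (fun k ε hε => (eventually_abs_ballFunction_sub_le hfp hs hM k hε).filter_mono
        nhdsWithin_le_nhds) hzΩ hz).congr' ?_
    filter_upwards [Ioo_mem_nhdsGT hT0] with δ hδ
    rw [hilbertBallThrough_eq hf hint hc hp hδ.1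
      (hint ▸ apply_add_smul_pos hxi hT hδ.1 hδ.2)]
  refine ⟨K, hball, fun K' hK' => hball.unique hK', ⟨?_, z, hKint ▸ hgz⟩, hKΩ, ?_, ?_⟩
  · rw [hKg] at hKc ⊢
    exact exists_finset_convexHull_eq_of_isCompact g hKc
  · exact ⟨subset_closure hxK, fun h => hx.2 (interior_mono hKΩ h)⟩
  · refine ⟨subset_closure hpK, fun h => ?_⟩
    obtain ⟨k, hk⟩ := exists_ballFunction_apply_self_eq_zero hfp hs
    rw [hKint] at h
    exact (h (Sum.inr k)).ne' hk
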